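/- Let $n\ge 1$ be an integer and let $\lambda_1,\dots,\lambda_n$ be the eigenvalues of $\mathrm{GUE}_n$, i.e. real random variables with joint density $$C_n\,\exp\Bigl(-\sum_{j=1}^n x_j^2\Bigr)\prod_{1\le j<k\le n}|x_j-x_k|^2\qquad (x\in\mathbb R^n),$$ $C_n$ being the normalization constant. Let $F_{n,2}(t)=\mathbb P(\max_j\lambda_j\le t)$. Let $\varphi_k(x)=(2^k k!\sqrt\pi)^{-1/2}H_k(x)e^{-x^2/2}$, where $H_k$ is the (physicists') Hermite polynomial of degree $k$, let $$K_{n,2}(x,y)=\sum_{k=0}^{n-1}\varphi_k(x)\varphi_k(y),$$ and for $t\in\mathbb R$ let $K_{n,2}$ also denote the integral operator with this kernel on $L^2(t,\infty)$. Then $I-K_{n,2}$ is invertible on $L^2(t,\infty)$ for every $t\in\mathbb R$. Put $$Q_n(\cdot\,;t)=(I-K_{n,2})^{-1}\bigl((n/2)^{1/4}\varphi_n\bigr),\qquad P_n(\cdot\,;t)=(I-K_{n,2})^{-1}\bigl((n/2)^{1/4}\varphi_{n-1}\bigr),$$ the inverse being taken on $L^2(t,\infty)$ and the continuous representatives being used,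 and $q_n(t)=Q_n(t;t)$, $p_n(t)=P_n(t;t)$. Then for every $t\in\mathbb R$ the Fredholm determinant $$\det(I-K_{n,2})=\sum_{m\ge0}\frac{(-1)^m}{m!}\int_{(t,\infty)^m}\det\bigl(K_{n,2}(x_i,x_j)\bigr)_{i,j=1}^m\,dx_1\cdots dx_m$$ on $L^2(t,\infty)$ exists (all the integrals and the series converge), the function $x\mapsto (x-t)\,q_n(x)\,p_n(x)$ is integrable on $(t,\infty)$, and $$F_{n,2}(t)=\det(I-K_{n,2})=\exp\Bigl(-2\int_t^\infty (x-t)\,q_n(x)\,p_n(x)\,dx\Bigr).$$ -/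

import Mathlib

open MeasureTheory Set Polynomial

namespace GUE

noncomputable section

/-! ### The law of the eigenvalues -/

/-- The unnormalized joint eigenvalue density of `GUE_n`. -/
def jointDensity (n : ℕ) (x : Fin n → ℝ) : ℝ :=
  Real.exp (-∑ i, x i ^ 2) * ∏ i, ∏ j ∈ Finset.Ioi i, |x i - x j| ^ 2

/-- The joint law of the eigenvalues of `GUE_n`: the measure on `ℝⁿ` whose density is
`jointDensity n` divided by its total integral. -/
def eigenvalueLaw (n : ℕ) : Measure (Fin n → ℝ) :=
  (∫⁻ x : Fin n → ℝ, ENNReal.ofReal (jointDensity n x))⁻¹ •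
    (volume : Measure (Fin n → ℝ)).withDensity (fun x => ENNReal.ofReal (jointDensity n x))

/-- The distribution function `F_{n,2}(t) = ℙ(λ_max ≤ t)` of the largest eigenvalue. -/
def largestEigenvalueCDF (n : ℕ) (t : ℝ) : ℝ :=
  (eigenvalueLaw n).real {x | ⨆ i, x i ≤ t}

/-! ### Fredholm determinants -/

/-- The `m`-th Fredholm minor integrand `det (K(x_i, x_j))_{1 ≤ i, j ≤ m}`. -/
def fredholmMinor (K : ℝ → ℝ → ℝ) (m : ℕ) (x : Fin m → ℝ) : ℝ :=
  (Matrix.of fun i j : Fin m => K (x i) (x j)).det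

/-- The `m`-th term of the Fredholm series of `det (I - K)` on `L²(μ)`. -/
def fredholmTerm (K : ℝ → ℝ → ℝ) (μ : Measure ℝ) (m : ℕ) : ℝ :=
  (-1) ^ m / (m.factorial : ℝ) * ∫ x, fredholmMinor K m x ∂(Measure.pi fun _ : Fin m => μ)

/-- `HasFredholmDet K μ d`: the Fredholm determinant `det (I - K)` of the integral operator with
kernel `K` on `L²(μ)` exists (every integral and the series converge) and equals `d`. -/
def HasFredholmDet (K : ℝ → ℝ → ℝ) (μ : Measure ℝ) (d : ℝ) : Prop :=
  (∀ m : ℕ, Integrable (fredholmMinor K m) (Measure.pi fun _ : Fin m => μ)) ∧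
    HasSum (fredholmTerm K μ) d

/-! ### Hermite functions and the Hermite kernel -/

/-- The (physicists') Hermite polynomials: `H_0 = 1`, `H_{n+1} = 2 x H_n - H_n'`. -/
def hermiteH : ℕ → ℝ[X]
  | 0 => 1
  | n + 1 => 2 * X * hermiteH n - derivative (hermiteH n)

/-- The orthonormal Hermite functions `(2ⁿ n! √π)^{-1/2} H_n(x) e^{-x²/2}`. -/
def hermiteFun (n : ℕ) (x : ℝ) : ℝ :=
  (Real.sqrt (2 ^ n * (n.factorial : ℝ) * Real.sqrt Real.pi))⁻¹ * (hermiteH n).eval x *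
    Real.exp (-x ^ 2 / 2)

/-- The Hermite kernel `K_n(x, y) = ∑_{k < n} φ_k(x) φ_k(y)`. -/
def hermiteKernel (n : ℕ) (x y : ℝ) : ℝ :=
  ∑ k ∈ Finset.range n, hermiteFun k x * hermiteFun k y

theorem continuous_hermiteFun (n : ℕ) : Continuous (hermiteFun n) := by
  unfold hermiteFun
  fun_prop

theorem integrable_poly_mul_gaussian (p : ℝ[X]) :
    Integrable (fun x : ℝ => p.eval x * Real.exp (-x ^ 2)) := by
  induction p using Polynomial.induction_on' with
  | add p q hp hq =>
    simp only [eval_add, add_mul]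
    exact hp.add hq
  | monomial m a =>
    have h := (integrable_rpow_mul_exp_neg_mul_sq (b := 1) one_pos (s := (m : ℝ))
      (by have : (0 : ℝ) ≤ m := m.cast_nonneg
          linarith)).const_mul a
    simpa [Real.rpow_natCast, mul_assoc] using h

theorem memLp_hermiteFun (n : ℕ) : MemLp (hermiteFun n) 2 volume := by
  rw [memLp_two_iff_integrable_sq (continuous_hermiteFun n).aestronglyMeasurable]
  have h := (integrable_poly_mul_gaussian (hermiteH n * hermiteH n)).const_mul
    ((Real.sqrt (2 ^ n * (n.factorial : ℝ) * Real.sqrt Real.pi))⁻¹ ^ 2)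
  refine h.congr (Filter.Eventually.of_forall fun x => ?_)
  have e : Real.exp (-x ^ 2) = Real.exp (-x ^ 2 / 2) ^ 2 := by
    rw [← Real.exp_nat_mul]
    congr 1
    push_cast
    ring
  simp only [hermiteFun, eval_mul, e]
  ring

/-! ### The operator `K_n` on `L²(t, ∞)` and the inverse of `I - K_n` -/

/-- The real Hilbert space `L²(t, ∞)`. -/
abbrev L2Ioi (t : ℝ) : Type := Lp ℝ 2 ((volume : Measure ℝ).restrict (Ioi t))

/-- The class in `L²(t, ∞)` of a square integrable function on `ℝ`. -/
def toL2 (t : ℝ) (g : ℝ → ℝ) (hg : MemLp g 2 volume) : L2Ioi t :=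
  (hg.restrict (Ioi t)).toLp g

/-- The operator `K_n` on `L²(t, ∞)`, that is `f ↦ ∑_{k < n} (φ_k, f) φ_k`. It is the integral
operator with kernel `hermiteKernel n`, see `hermiteOp_ae`. -/
def hermiteOp (n : ℕ) (t : ℝ) : L2Ioi t →L[ℝ] L2Ioi t :=
  ∑ k ∈ Finset.range n,
    (innerSL ℝ (toL2 t (hermiteFun k) (memLp_hermiteFun k))).smulRight
      (toL2 t (hermiteFun k) (memLp_hermiteFun k))

theorem integrable_hermiteFun_mul (k : ℕ) (t : ℝ) (f : L2Ioi t) :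
    Integrable (fun y => hermiteFun k y * f y) (volume.restrict (Ioi t)) :=
  ((memLp_hermiteFun k).restrict (Ioi t)).integrable_mul (Lp.memLp f)

theorem integral_hermiteKernel_mul (n : ℕ) (t : ℝ) (f : L2Ioi t) (x : ℝ) :
    ∫ y in Ioi t, hermiteKernel n x y * f y =
      ∑ k ∈ Finset.range n, (∫ y in Ioi t, hermiteFun k y * f y) * hermiteFun k x := by
  simp only [hermiteKernel, Finset.sum_mul, mul_assoc]
  rw [integral_finsetSum]
  · refine Finset.sum_congr rfl fun k _ => ?_
    rw [integral_const_mul, mul_comm]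
  · exact fun k _ => (integrable_hermiteFun_mul k t f).const_mul _

/-- `hermiteOp n t` is the integral operator on `L²(t, ∞)` with kernel `hermiteKernel n`. -/
theorem hermiteOp_ae (n : ℕ) (t : ℝ) (f : L2Ioi t) :
    hermiteOp n t f =ᵐ[volume.restrict (Ioi t)]
      fun x => ∫ y in Ioi t, hermiteKernel n x y * f y := by
  simp only [integral_hermiteKernel_mul]
  have hin : ∀ k, inner ℝ (toL2 t (hermiteFun k) (memLp_hermiteFun k)) f =
      ∫ y in Ioi t, hermiteFun k y * f y := by
    intro k
    rw [L2.inner_def]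
    refine integral_congr_ae ?_
    filter_upwards [((memLp_hermiteFun k).restrict (Ioi t)).coeFn_toLp] with y hy
    simp [toL2, hy, mul_comm]
  have happ : hermiteOp n t f = ∑ k ∈ Finset.range n,
      (∫ y in Ioi t, hermiteFun k y * f y) • toL2 t (hermiteFun k) (memLp_hermiteFun k) := by
    simp [hermiteOp, hin]
  rw [happ]
  clear happ
  induction n with
  | zero =>
    simp only [Finset.range_zero, Finset.sum_empty]
    exact Lp.coeFn_zero ℝ 2 (volume.restrict (Ioi t))
  | succ n ih =>
    rw [Finset.sum_range_succ]
    simp only [Finset.sum_range_succ]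
    filter_upwards [ih, Lp.coeFn_add
      (∑ k ∈ Finset.range n, (∫ y in Ioi t, hermiteFun k y * f y) •
        toL2 t (hermiteFun k) (memLp_hermiteFun k))
      ((∫ y in Ioi t, hermiteFun n y * f y) • toL2 t (hermiteFun n) (memLp_hermiteFun n)),
      Lp.coeFn_smul (∫ y in Ioi t, hermiteFun n y * f y)
        (toL2 t (hermiteFun n) (memLp_hermiteFun n)),
      ((memLp_hermiteFun n).restrict (Ioi t)).coeFn_toLp] with x h1 h2 h3 h4
    rw [h2, Pi.add_apply, h1, h3, Pi.smul_apply, smul_eq_mul, toL2, h4]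

/-- The function `(I - K_n)⁻¹ g` on `L²(t, ∞)`, in its pointwise version given by
`(I - K_n)⁻¹ g = g + K_n (I - K_n)⁻¹ g`: for continuous `g` this is the continuous representative
(`continuous_invOneSub`, `invOneSub_ae`). `Ring.inverse` is the inverse of the operator `I - K_n`
whenever that operator is invertible. -/
def invOneSub (n : ℕ) (t : ℝ) (g : ℝ → ℝ) (hg : MemLp g 2 volume) (x : ℝ) : ℝ :=
  g x + ∫ y in Ioi t, hermiteKernel n x y * (Ring.inverse (1 - hermiteOp n t) (toL2 t g hg)) y

theorem continuous_invOneSub (n : ℕ) (t : ℝ) (g : ℝ → ℝ) (hg : MemLp g 2 volume)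
    (hc : Continuous g) : Continuous (invOneSub n t g hg) := by
  unfold invOneSub
  simp only [integral_hermiteKernel_mul]
  have := continuous_hermiteFun
  fun_prop

theorem invOneSub_ae (n : ℕ) (t : ℝ) (g : ℝ → ℝ) (hg : MemLp g 2 volume)
    (h : IsUnit (1 - hermiteOp n t)) :
    invOneSub n t g hg =ᵐ[volume.restrict (Ioi t)]
      Ring.inverse (1 - hermiteOp n t) (toL2 t g hg) := by
  have hmul := Ring.mul_inverse_cancel _ h
  set S := Ring.inverse (1 - hermiteOp n t) with hS
  have e : S (toL2 t g hg) = toL2 t g hg + hermiteOp n t (S (toL2 t g hg)) := by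
    have := congrArg (fun T : L2Ioi t →L[ℝ] L2Ioi t => T (toL2 t g hg)) hmul
    simp only [mul_apply_eq_comp, sub_apply,
      one_apply_eq_self] at this
    exact sub_eq_iff_eq_add.mp this
  have e' : (S (toL2 t g hg) : ℝ → ℝ) =ᵐ[volume.restrict (Ioi t)]
      (toL2 t g hg + hermiteOp n t (S (toL2 t g hg)) : L2Ioi t) := by
    rw [← e]
  filter_upwards [e', Lp.coeFn_add (toL2 t g hg) (hermiteOp n t (S (toL2 t g hg))),
    hermiteOp_ae n t (S (toL2 t g hg)), (hg.restrict (Ioi t)).coeFn_toLp] with x h1 h2 h3 h4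
  rw [h1, h2, Pi.add_apply, h3, toL2, h4]
  rfl

/-! ### The functions `q_n` and `p_n` -/

/-- The function `φ = (n/2)^{1/4} φ_n`. -/
def phi (n : ℕ) (x : ℝ) : ℝ := ((n : ℝ) / 2) ^ ((1 : ℝ) / 4) * hermiteFun n x

/-- The function `ψ = (n/2)^{1/4} φ_{n-1}` (for `n ≥ 1`). -/
def psi (n : ℕ) (x : ℝ) : ℝ := ((n : ℝ) / 2) ^ ((1 : ℝ) / 4) * hermiteFun (n - 1) x

theorem memLp_phi (n : ℕ) : MemLp (phi n) 2 volume := (memLp_hermiteFun n).const_mul _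

theorem memLp_psi (n : ℕ) : MemLp (psi n) 2 volume := (memLp_hermiteFun (n - 1)).const_mul _

/-- `Q_n(x; t) = ((I - K_n)⁻¹ φ)(x)`, the inverse being taken on `L²(t, ∞)`. -/
def bigQ (n : ℕ) (x t : ℝ) : ℝ := invOneSub n t (phi n) (memLp_phi n) x

/-- `P_n(x; t) = ((I - K_n)⁻¹ ψ)(x)`, the inverse being taken on `L²(t, ∞)`. -/
def bigP (n : ℕ) (x t : ℝ) : ℝ := invOneSub n t (psi n) (memLp_psi n) x

/-- `q_n(t) = Q_n(t; t)`. -/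
def q (n : ℕ) (t : ℝ) : ℝ := bigQ n t t

/-- `p_n(t) = P_n(t; t)`. -/
def p (n : ℕ) (t : ℝ) : ℝ := bigP n t t

end

end GUE

namespace GUE

/-! ### Hermite polynomials -/

/-! Everything reduces to the `n × n` Gram matrix `G(t)` of `φ_0, …, φ_{n-1}` on `(-∞, t]`
(`gramIic`). By orthonormality `G(t) = 1 - A(t)`, where `A(t)` is the Gram matrix on `(t, ∞)`. The
Fredholm series of the finite-rank kernel therefore sums to `det G(t)`
(`hasFredholmDet_hermiteKernel`). The eigenvalue density is a multiple of the squared determinant of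
the `φ_i(x_j)`, so the Andréief identity gives `F_{n,2}(t) = det G(t)`
(`largestEigenvalueCDF_eq_det`). Linear independence of the `φ_k` on `(-∞, t)` makes `G(t)`
invertible, and inverting `I - K_n` amounts to inverting `G(t)`; this gives closed forms for `q_n`
and `p_n` (`q_eq`, `p_eq`).

Let `v = (φ_0(t), …, φ_{n-1}(t))`. Since `G' = v vᵀ`, the logarithmic derivative of `det G` is `R =
v · G⁻¹v`, and `R' = 2 v' · G⁻¹v - R²`. The ladder relations give `v' = M v - s φ_n e`, with `M`
antisymmetric, `s = √(n/2)` and `e` the last basis vector. Integrating `(φ_i φ_j)'` over `(-∞, t]`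
gives `v vᵀ = M G - G M - s (e cᵀ + c eᵀ)`, where `c` collects the overlaps with `φ_n`
(`gramIic_commutator`). Evaluating this form at `G⁻¹v` expresses `R²`, and what remains is `R' = -2
q_n p_n` (`quadratic_form_identity`). Two integrations from `+∞`, where everything decays
exponentially, give the formula. -/

theorem natDegree_hermiteH_le (n : ℕ) : (hermiteH n).natDegree ≤ n := by
  induction n with
  | zero => simp [hermiteH]
  | succ n ih =>
    rw [hermiteH]
    refine (natDegree_sub_le _ _).trans (max_le ?_ ?_)
    · have h2 : (2 * X * hermiteH n : ℝ[X]) = C 2 * (X * hermiteH n) := by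
        rw [← mul_assoc]; rfl
      rw [h2]
      refine (natDegree_C_mul_le _ _).trans (natDegree_mul_le.trans ?_)
      rw [natDegree_X]
      lia
    · exact (natDegree_derivative_le _).trans (by lia)

theorem coeff_hermiteH_self (n : ℕ) : (hermiteH n).coeff n = 2 ^ n := by
  induction n with
  | zero => simp [hermiteH]
  | succ n ih =>
    have h2 : (2 * X * hermiteH n : ℝ[X]) = C 2 * (X * hermiteH n) := by
      rw [← mul_assoc]; rfl
    rw [hermiteH, coeff_sub, h2, coeff_C_mul, coeff_X_mul, ih, coeff_derivative,
      coeff_eq_zero_of_natDegree_lt ((natDegree_hermiteH_le n).trans_lt (by lia))]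
    ring

theorem natDegree_hermiteH (n : ℕ) : (hermiteH n).natDegree = n :=
  natDegree_eq_of_le_of_coeff_ne_zero (natDegree_hermiteH_le n)
    (by rw [coeff_hermiteH_self]; positivity)

theorem derivative_hermiteH_succ (n : ℕ) :
    derivative (hermiteH (n + 1)) = (2 * (n + 1) : ℝ[X]) * hermiteH n := by
  induction n with
  | zero => simp [hermiteH]
  | succ n ih =>
    rw [hermiteH, derivative_sub, ih, derivative_mul, derivative_mul, derivative_mul, ih]
    have h1 : derivative (2 * ((n : ℝ[X]) + 1)) = 0 := by
      have : (2 * ((n : ℝ[X]) + 1)) = C (2 * ((n : ℝ) + 1)) := by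
        rw [C_mul, C_add, C_1, C_eq_natCast]
        rfl
      rw [this, derivative_C]
    rw [h1]
    have h2 : derivative (2 : ℝ[X]) = 0 := by
      have : (2 : ℝ[X]) = C 2 := rfl
      rw [this, derivative_C]
    rw [h2, derivative_X]
    push_cast
    conv_rhs => rw [hermiteH]
    rw [hermiteH]
    ring

theorem integral_derivative_sub_mul_gaussian (P : ℝ[X]) :
    ∫ x : ℝ, (derivative P - 2 * X * P).eval x * Real.exp (-x ^ 2) = 0 := by
  refine integral_eq_zero_of_hasDerivAt_of_integrable
    (f := fun x : ℝ => P.eval x * Real.exp (-x ^ 2)) (fun x => ?_)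
    (integrable_poly_mul_gaussian _) (integrable_poly_mul_gaussian _)
  refine ((P.hasDerivAt x).mul ((hasDerivAt_pow 2 x).neg.exp)).congr_deriv ?_
  simp
  ring

/-- Integration by parts: `H_{k+1} e^{-x²} = -(H_k e^{-x²})'`, so one derivative moves onto `P`. -/
theorem integral_mul_hermiteH_succ (P : ℝ[X]) (k : ℕ) :
    ∫ x : ℝ, (P * hermiteH (k + 1)).eval x * Real.exp (-x ^ 2) =
      ∫ x : ℝ, (derivative P * hermiteH k).eval x * Real.exp (-x ^ 2) := by
  have h := integral_derivative_sub_mul_gaussian (P * hermiteH k)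
  rw [← sub_eq_zero, ← integral_sub (integrable_poly_mul_gaussian _)
    (integrable_poly_mul_gaussian _), ← neg_eq_zero, ← integral_neg, ← h]
  congr 1
  ext x
  rw [hermiteH, derivative_mul]
  simp only [eval_mul, eval_sub, eval_add]
  ring

/-- Each integration by parts lowers both indices, by `H_{j+1}' = 2(j+1) H_j`. For `j ≠ k` one index
reaches `0` first, and the next derivative falls on a constant. -/
theorem integral_hermiteH_mul_hermiteH (j k : ℕ) :
    ∫ x : ℝ, (hermiteH j * hermiteH k).eval x * Real.exp (-x ^ 2) =
      if j = k then 2 ^ k * (k.factorial : ℝ) * Real.sqrt Real.pi else 0 := by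
  induction j generalizing k with
  | zero =>
    cases k with
    | zero => simpa [hermiteH] using integral_gaussian 1
    | succ k => rw [integral_mul_hermiteH_succ]; simp [hermiteH]
  | succ j ih =>
    cases k with
    | zero => rw [mul_comm, integral_mul_hermiteH_succ]; simp [hermiteH]
    | succ k =>
      have h (x : ℝ) : (2 * ((j : ℝ[X]) + 1) * hermiteH j * hermiteH k).eval x * Real.exp (-x ^ 2) =
          2 * ((j : ℝ) + 1) * ((hermiteH j * hermiteH k).eval x * Real.exp (-x ^ 2)) := by
        simp
        ring
      rw [integral_mul_hermiteH_succ, derivative_hermiteH_succ]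
      simp_rw [h]
      rw [integral_const_mul, ih]
      by_cases hjk : j = k
      · simp [hjk, Nat.factorial_succ]
        ring
      · simp [hjk]

/-! ### Hermite functions -/

theorem hermiteFun_mul_hermiteFun (j k : ℕ) (x : ℝ) :
    hermiteFun j x * hermiteFun k x =
      (Real.sqrt (2 ^ j * (j.factorial : ℝ) * Real.sqrt Real.pi))⁻¹ *
      (Real.sqrt (2 ^ k * (k.factorial : ℝ) * Real.sqrt Real.pi))⁻¹ *
      ((hermiteH j * hermiteH k).eval x * Real.exp (-x ^ 2)) := by
  have e : Real.exp (-x ^ 2) = Real.exp (-x ^ 2 / 2) * Real.exp (-x ^ 2 / 2) := by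
    rw [← Real.exp_add]
    ring_nf
  simp only [hermiteFun, eval_mul, e]
  ring

theorem integrable_hermiteFun_mul_hermiteFun (j k : ℕ) :
    Integrable fun x => hermiteFun j x * hermiteFun k x := by
  simp only [hermiteFun_mul_hermiteFun]
  exact (integrable_poly_mul_gaussian _).const_mul _

theorem integral_hermiteFun_mul_hermiteFun (j k : ℕ) :
    ∫ x, hermiteFun j x * hermiteFun k x = if j = k then 1 else 0 := by
  simp only [hermiteFun_mul_hermiteFun]
  rw [integral_const_mul, integral_hermiteH_mul_hermiteH]
  split_ifs with h
  · subst h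
    rw [← mul_inv, Real.mul_self_sqrt (by positivity), inv_mul_cancel₀ (by positivity)]
  · simp

/-- The coefficient `√(k/2)` of the ladder relations. -/
noncomputable def ladder (k : ℕ) : ℝ := Real.sqrt ((k : ℝ) / 2)

theorem normalization_succ (k : ℕ) :
    Real.sqrt (2 ^ (k + 1) * ((k + 1).factorial : ℝ) * Real.sqrt Real.pi) =
      2 * ladder (k + 1) * Real.sqrt (2 ^ k * (k.factorial : ℝ) * Real.sqrt Real.pi) := by
  rw [ladder, show (2 : ℝ) = Real.sqrt (2 ^ 2) by rw [Real.sqrt_sq]; norm_num]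
  rw [← Real.sqrt_mul (by positivity), ← Real.sqrt_mul (by positivity)]
  congr 1
  rw [Real.sqrt_sq (by norm_num), Nat.factorial_succ]
  push_cast
  ring

theorem ladder_succ_pos (k : ℕ) : 0 < ladder (k + 1) :=
  Real.sqrt_pos.2 (by positivity)

theorem ladder_mul_self (k : ℕ) : ladder k * ladder k = k / 2 :=
  Real.mul_self_sqrt (by positivity)

/-- Eliminate `x H_k` from `φ_k'` by the recursion `H_{k+1} = 2x H_k - H_k'`, then use `H_k' = 2k
H_{k-1}`. At `k = 0` the truncated index `k - 1` is harmless because `ladder 0 = 0`. -/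
theorem hasDerivAt_hermiteFun (k : ℕ) (x : ℝ) :
    HasDerivAt (hermiteFun k)
      (ladder k * hermiteFun (k - 1) x - ladder (k + 1) * hermiteFun (k + 1) x) x := by
  set c : ℝ := (Real.sqrt (2 ^ k * (k.factorial : ℝ) * Real.sqrt Real.pi))⁻¹ with hc
  have hd : HasDerivAt (hermiteFun k)
      (c * ((derivative (hermiteH k)).eval x - x * (hermiteH k).eval x) *
        Real.exp (-x ^ 2 / 2)) x := by
    refine ((((hermiteH k).hasDerivAt x).const_mul c).mul
      (((hasDerivAt_pow 2 x).neg.div_const 2).exp)).congr_deriv ?_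
    simp
    ring
  refine hd.congr_deriv ?_
  have h2 : ladder (k + 1) * hermiteFun (k + 1) x =
      c / 2 * (2 * x * (hermiteH k).eval x - (derivative (hermiteH k)).eval x) *
        Real.exp (-x ^ 2 / 2) := by
    rw [hermiteFun, normalization_succ, hermiteH, hc]
    have := (ladder_succ_pos k).ne'
    simp
    field_simp
  have h1 : ladder k * hermiteFun (k - 1) x =
      c / 2 * (derivative (hermiteH k)).eval x * Real.exp (-x ^ 2 / 2) := by
    cases k with
    | zero => simp [ladder, hermiteH]
    | succ k =>
      rw [hc, normalization_succ, derivative_hermiteH_succ]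
      have h3 := (ladder_succ_pos k).ne'
      have h4 := ladder_mul_self (k + 1)
      push_cast at h4
      simp only [Nat.add_sub_cancel, hermiteFun, eval_mul, eval_add, eval_natCast, eval_one,
        eval_ofNat]
      rw [mul_inv, mul_inv]
      rw [show (k : ℝ) + 1 = 2 * (ladder (k + 1) * ladder (k + 1)) by linarith]
      field_simp
  rw [h1, h2]
  ring

/-- The rate `2` is a convenient choice: it leaves room to absorb a factor `x - t = O(eˣ)` later and
still have decay. -/
theorem hermiteFun_isBigO_atTop (k : ℕ) :
    hermiteFun k =O[Filter.atTop] fun x => Real.exp (-(2 * x)) := by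
  have h1 : (fun x => (hermiteH k).eval x) =O[Filter.atTop] fun x => Real.exp x :=
    (Asymptotics.isLittleO_of_tendsto (fun x hx => absurd hx (Real.exp_ne_zero x))
      (hermiteH k).tendsto_div_exp_atTop).isBigO
  have h2 : (fun x : ℝ => Real.exp (-x ^ 2 / 2)) =O[Filter.atTop] fun x => Real.exp (-(3 * x)) := by
    refine Asymptotics.IsBigO.of_bound 1 ?_
    filter_upwards [Filter.eventually_ge_atTop 6] with x hx
    rw [Real.norm_of_nonneg (Real.exp_pos _).le, Real.norm_of_nonneg (Real.exp_pos _).le, one_mul]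
    exact Real.exp_le_exp.2 (by nlinarith)
  refine ((h1.const_mul_left _).mul h2).congr (fun x => rfl) fun x => ?_
  rw [← Real.exp_add]
  ring_nf

/-! ### The Andréief identity -/

section Andreief

variable {ι α : Type*} [Fintype ι] [DecidableEq ι]

theorem prod_mul_det_eq_sum (f g : ι → α → ℝ) (x : ι → α) :
    (∏ j, f j (x j)) * (Matrix.of fun i j => g i (x j)).det =
      ∑ σ : Equiv.Perm ι, ((Equiv.Perm.sign σ : ℤ) : ℝ) * ∏ j, f j (x j) * g (σ j) (x j) := by
  rw [Matrix.det_apply', Finset.mul_sum]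
  refine Finset.sum_congr rfl fun σ _ => ?_
  simp only [Matrix.of_apply, Finset.prod_mul_distrib]
  ring

theorem det_mul_det_eq_sum (f g : ι → α → ℝ) (x : ι → α) :
    (Matrix.of fun i j => f i (x j)).det * (Matrix.of fun i j => g i (x j)).det =
      ∑ σ : Equiv.Perm ι, ((Equiv.Perm.sign σ : ℤ) : ℝ) *
        ((∏ j, f (σ j) (x j)) * (Matrix.of fun i j => g i (x j)).det) := by
  rw [Matrix.det_apply', Finset.sum_mul]
  simp only [Matrix.of_apply, mul_assoc]

variable [MeasurableSpace α] {μ : Measure α} [SigmaFinite μ] {f g : ι → α → ℝ}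

theorem integrable_prod_mul_det (h : ∀ i j, Integrable (fun a => f i a * g j a) μ) :
    Integrable (fun x : ι → α => (∏ j, f j (x j)) * (Matrix.of fun i j => g i (x j)).det)
      (Measure.pi fun _ => μ) := by
  simp only [prod_mul_det_eq_sum]
  exact integrable_finsetSum _ fun σ _ =>
    (Integrable.fintype_prod fun j => h j (σ j)).const_mul _

/-- Expanding the determinant leaves products of one-variable functions, which Fubini factors. This
half of Andréief also computes the Fredholm terms. -/
theorem integral_prod_mul_det (h : ∀ i j, Integrable (fun a => f i a * g j a) μ) :
    ∫ x : ι → α, (∏ j, f j (x j)) * (Matrix.of fun i j => g i (x j)).det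
        ∂(Measure.pi fun _ => μ) =
      (Matrix.of fun i j => ∫ a, f j a * g i a ∂μ).det := by
  simp only [prod_mul_det_eq_sum]
  rw [integral_finsetSum _ fun σ _ =>
    (Integrable.fintype_prod fun j => h j (σ j)).const_mul _, Matrix.det_apply']
  refine Finset.sum_congr rfl fun σ _ => ?_
  rw [integral_const_mul]
  congr 1
  exact integral_fintype_prod_eq_prod (fun j a => f j a * g (σ j) a)

theorem integrable_det_mul_det (h : ∀ i j, Integrable (fun a => f i a * g j a) μ) :
    Integrable (fun x : ι → α =>
      (Matrix.of fun i j => f i (x j)).det * (Matrix.of fun i j => g i (x j)).det)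
      (Measure.pi fun _ => μ) := by
  simp only [det_mul_det_eq_sum]
  exact integrable_finsetSum _ fun σ _ =>
    (integrable_prod_mul_det (f := fun j => f (σ j)) fun i j => h (σ i) j).const_mul _

/-- The Andréief identity. -/
theorem integral_det_mul_det (h : ∀ i j, Integrable (fun a => f i a * g j a) μ) :
    ∫ x : ι → α, (Matrix.of fun i j => f i (x j)).det * (Matrix.of fun i j => g i (x j)).det
        ∂(Measure.pi fun _ => μ) =
      (Fintype.card ι).factorial * (Matrix.of fun i j => ∫ a, f j a * g i a ∂μ).det := by
  simp only [det_mul_det_eq_sum]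
  rw [integral_finsetSum _ fun σ _ =>
    (integrable_prod_mul_det (f := fun j => f (σ j)) fun i j => h (σ i) j).const_mul _]
  -- Permuting the `f j` permutes the columns of the Gram matrix; the resulting sign cancels the
  -- sign of `σ`, so all the terms are equal.
  have key (σ : Equiv.Perm ι) :
      ∫ x : ι → α, ((Equiv.Perm.sign σ : ℤ) : ℝ) *
        ((∏ j, f (σ j) (x j)) * (Matrix.of fun i j => g i (x j)).det) ∂(Measure.pi fun _ => μ) =
      (Matrix.of fun i j => ∫ a, f j a * g i a ∂μ).det := by
    rw [integral_const_mul,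
      integral_prod_mul_det (f := fun j => f (σ j)) fun i j => h (σ i) j]
    have := Matrix.det_permute' σ (Matrix.of fun i j => ∫ a, f j a * g i a ∂μ)
    rw [show (Matrix.of fun i j => ∫ a, f (σ j) a * g i a ∂μ) =
      (Matrix.of fun i j => ∫ a, f j a * g i a ∂μ).submatrix id σ from rfl, this, ← mul_assoc]
    rcases Int.units_eq_one_or (Equiv.Perm.sign σ) with h | h <;> simp [h]
  simp only [key, Finset.sum_const, Finset.card_univ, Fintype.card_perm, nsmul_eq_mul]

end Andreief

/-! ### Principal minors -/

section Minors

variable {R : Type*} [CommRing R]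

theorem card_filter_injective_image_eq {α : Type*} [DecidableEq α] [Fintype α] {m : ℕ}
    {s : Finset α} (hs : s.card = m) :
    (Finset.univ.filter fun h : Fin m → α =>
      Function.Injective h ∧ Finset.univ.image h = s).card = m.factorial := by
  have e : Fin m ≃ s := (Finset.equivFinOfCardEq hs).symm
  have hc : Fintype.card (Fin m ≃ s) = m.factorial := by
    rw [Fintype.card_equiv e, Fintype.card_fin]
  rw [← hc, ← Finset.card_univ]
  symm
  refine Finset.card_bij (fun e _ => fun i => ((e i : s) : α)) ?_ ?_ ?_
  · intro e _
    simp only [Finset.mem_filter, Finset.mem_univ, true_and]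
    refine ⟨Subtype.val_injective.comp e.injective, ?_⟩
    ext a
    simp only [Finset.mem_image, Finset.mem_univ, true_and]
    constructor
    · rintro ⟨i, rfl⟩
      exact (e i).2
    · intro ha
      exact ⟨e.symm ⟨a, ha⟩, by simp⟩
  · intro e _ e' _ h
    ext i
    exact congrFun h i
  · intro h hh
    simp only [Finset.mem_filter, Finset.mem_univ, true_and] at hh
    obtain ⟨hi, him⟩ := hh
    have hmem : ∀ i, h i ∈ s := fun i => him ▸ Finset.mem_image_of_mem h (Finset.mem_univ i)
    refine ⟨Equiv.ofBijective (fun i => (⟨h i, hmem i⟩ : s)) ⟨?_, ?_⟩, Finset.mem_univ _, rfl⟩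
    · intro i j hij
      exact hi (congrArg Subtype.val hij)
    · rintro ⟨a, ha⟩
      rw [← him, Finset.mem_image] at ha
      obtain ⟨i, -, rfl⟩ := ha
      exact ⟨i, rfl⟩

/-- A non-injective `h` repeats a row. The injective ones are grouped by image: each of the `m!`
enumerations of `s` gives the same principal minor. -/
theorem sum_det_submatrix {α : Type*} [DecidableEq α] [Fintype α] (M : Matrix α α R) (m : ℕ) :
    ∑ h : Fin m → α, (M.submatrix h h).det =
      m.factorial * ∑ s ∈ Finset.univ.powersetCard m,
        (M.submatrix (Subtype.val : s → α) (Subtype.val : s → α)).det := by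
  have h1 : ∑ h : Fin m → α, (M.submatrix h h).det =
      ∑ h ∈ Finset.univ.filter (fun h : Fin m → α => Function.Injective h),
        (M.submatrix h h).det := by
    symm
    refine Finset.sum_subset (Finset.filter_subset _ _) fun h _ hh => ?_
    obtain ⟨i, j, hij, hne⟩ := Function.not_injective_iff.1
      fun hi => hh (Finset.mem_filter.2 ⟨Finset.mem_univ h, hi⟩)
    exact Matrix.det_zero_of_row_eq hne (by ext k; simp [hij])
  rw [h1, ← Finset.sum_fiberwise_of_maps_to (t := Finset.univ.powersetCard m)
    (g := fun h : Fin m → α => Finset.univ.image h), Finset.mul_sum]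
  · refine Finset.sum_congr rfl fun s hs => ?_
    have hs' := (Finset.mem_powersetCard.1 hs).2
    rw [Finset.filter_filter, ← card_filter_injective_image_eq hs', ← nsmul_eq_mul]
    refine Finset.sum_eq_card_nsmul fun h hh => ?_
    simp only [Finset.mem_filter, Finset.mem_univ, true_and] at hh
    obtain ⟨hi, him⟩ := hh
    have hmem : ∀ i, h i ∈ s := fun i => him ▸ Finset.mem_image_of_mem h (Finset.mem_univ i)
    let e : Fin m ≃ s := Equiv.ofBijective (fun i => (⟨h i, hmem i⟩ : s)) ⟨fun i j hij =>
      hi (congrArg Subtype.val hij), by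
        rintro ⟨a, ha⟩
        rw [← him, Finset.mem_image] at ha
        obtain ⟨i, -, rfl⟩ := ha
        exact ⟨i, rfl⟩⟩
    rw [← Matrix.det_submatrix_equiv_self e]
    rfl
  · intro h hh
    simp only [Finset.mem_filter, Finset.mem_univ, true_and] at hh
    rw [Finset.mem_powersetCard]
    exact ⟨Finset.subset_univ _, by rw [Finset.card_image_of_injective _ hh, Finset.card_fin]⟩

/-- The coefficients of the polynomial `det (1 + X M)` are the sums of principal minors. Evaluation
at `X = -1` gives the series, which has finitely many nonzero terms. -/
theorem hasSum_det_one_sub {α : Type*} [DecidableEq α] [Fintype α] (M : Matrix α α ℝ) :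
    HasSum (fun m : ℕ => (-1) ^ m / (m.factorial : ℝ) *
      ∑ h : Fin m → α, (M.submatrix h h).det) (1 - M).det := by
  set P : ℝ[X] := (1 + (X : ℝ[X]) • M.map C).det with hP
  have hterm (m : ℕ) : (-1) ^ m / (m.factorial : ℝ) * ∑ h : Fin m → α, (M.submatrix h h).det =
      P.coeff m * (-1) ^ m := by
    rw [sum_det_submatrix, hP, Matrix.coeff_det_one_add_X_smul_eq_sum_minors]
    have : (m.factorial : ℝ) ≠ 0 := by positivity
    field_simp
  have hdet : (1 - M).det = ∑ m ∈ P.support, P.coeff m * (-1) ^ m := by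
    have h1 : P.eval (-1) = (1 - M).det := by
      rw [hP, ← coe_evalRingHom, RingHom.map_det]
      congr 1
      ext i j
      simp [Matrix.one_apply, sub_eq_add_neg, apply_ite]
    rw [← h1, eval_eq_sum, Polynomial.sum]
  rw [hdet]
  simp only [hterm]
  refine hasSum_sum_of_ne_finset_zero fun m hm => ?_
  rw [notMem_support_iff.1 hm, zero_mul]

end Minors

/-! ### Fredholm determinants of degenerate kernels -/

section Degenerate

variable {ν : Type*} [Fintype ν]

/-- Each row is a linear combination of the vectors `(f k (x j))_j`, so multilinearity in the rows
applies. -/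
theorem fredholmMinor_degenerate (f : ν → ℝ → ℝ) (m : ℕ) (x : Fin m → ℝ) :
    fredholmMinor (fun a b => ∑ k, f k a * f k b) m x =
      ∑ h : Fin m → ν, (∏ j, f (h j) (x j)) * (Matrix.of fun i j => f (h i) (x j)).det := by
  have h1 : (Matrix.of fun i j : Fin m => ∑ k, f k (x i) * f k (x j)) =
      fun i => ∑ k, f k (x i) • fun j => f k (x j) := by
    ext i j
    simp
  rw [fredholmMinor, h1]
  have := (Matrix.detRowAlternating (n := Fin m) (R := ℝ)).toMultilinearMap.map_sum
    (fun i k => f k (x i) • fun j => f k (x j))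
  refine this.trans (Finset.sum_congr rfl fun h _ => ?_)
  exact (Matrix.detRowAlternating (n := Fin m) (R := ℝ)).toMultilinearMap.map_smul_univ _ _

variable [DecidableEq ν] {μ : Measure ℝ} [SigmaFinite μ]

/-- The Fredholm determinant of a degenerate kernel `∑ k, f_k ⊗ f_k` is `det (1 - (∫ f_i f_j))`. -/
theorem hasFredholmDet_degenerate {f : ν → ℝ → ℝ}
    (hf : ∀ i j, Integrable (fun a => f i a * f j a) μ) :
    HasFredholmDet (fun a b => ∑ k, f k a * f k b) μ
      (1 - Matrix.of fun i j => ∫ a, f i a * f j a ∂μ).det := by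
  have hint (m : ℕ) (h : Fin m → ν) := integrable_prod_mul_det (μ := μ) (f := fun i => f (h i))
    (g := fun i => f (h i)) fun i j => hf (h i) (h j)
  refine ⟨fun m => ?_, ?_⟩
  · have : fredholmMinor (fun a b => ∑ k, f k a * f k b) m = _ :=
      funext (fredholmMinor_degenerate f m)
    rw [this]
    exact integrable_finsetSum _ fun h _ => hint m h
  · convert hasSum_det_one_sub (Matrix.of fun i j => ∫ a, f i a * f j a ∂μ) using 2 with m
    rw [fredholmTerm]
    congr 1
    simp only [fredholmMinor_degenerate]
    rw [integral_finsetSum _ fun h _ => hint m h]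
    refine Finset.sum_congr rfl fun h _ => ?_
    rw [integral_prod_mul_det (f := fun i => f (h i)) (g := fun i => f (h i))
      fun i j => hf (h i) (h j)]
    congr 1
    ext i j
    simp [mul_comm]

end Degenerate

/-! ### Gram matrices of the Hermite functions -/

/-- The vector `(φ_0(x), …, φ_{n-1}(x))`. -/
noncomputable def hermiteVec (n : ℕ) (x : ℝ) : Fin n → ℝ := fun i => hermiteFun i x

/-- The Gram matrix of `φ_0, …, φ_{n-1}` on `(-∞, t]`. -/
noncomputable def gramIic (n : ℕ) (t : ℝ) : Matrix (Fin n) (Fin n) ℝ :=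
  Matrix.of fun i j => ∫ x in Iic t, hermiteFun i x * hermiteFun j x

theorem integral_Ioi_hermiteFun_mul (j k : ℕ) (t : ℝ) :
    ∫ x in Ioi t, hermiteFun j x * hermiteFun k x =
      (if j = k then 1 else 0) - ∫ x in Iic t, hermiteFun j x * hermiteFun k x := by
  rw [← integral_hermiteFun_mul_hermiteFun, ← intervalIntegral.integral_Iic_add_Ioi (b := t)
    (integrable_hermiteFun_mul_hermiteFun j k).integrableOn
    (integrable_hermiteFun_mul_hermiteFun j k).integrableOn]
  ring

theorem hermiteKernel_eq_sum_fin (n : ℕ) (x y : ℝ) :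
    hermiteKernel n x y = ∑ k : Fin n, hermiteFun k x * hermiteFun k y :=
  Finset.sum_range _

theorem hasFredholmDet_hermiteKernel (n : ℕ) (t : ℝ) :
    HasFredholmDet (hermiteKernel n) (volume.restrict (Ioi t)) (gramIic n t).det := by
  have h := hasFredholmDet_degenerate (μ := volume.restrict (Ioi t))
    (f := fun k : Fin n => hermiteFun k)
    fun i j => (integrable_hermiteFun_mul_hermiteFun i j).integrableOn
  have hK : hermiteKernel n = fun a b => ∑ k : Fin n, hermiteFun k a * hermiteFun k b := by
    ext a b
    exact hermiteKernel_eq_sum_fin n a b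
  rw [hK]
  convert h using 2
  ext i j
  simp [gramIic, integral_Ioi_hermiteFun_mul, Matrix.one_apply, Fin.ext_iff]

/-- `2^{-i} H_i` is monic of degree `i`, so the determinant of the `φ_i(x_j)` is a Vandermonde
product times Gaussian weights and a constant. The value of `c` is immaterial, since the law is
normalized by its total mass. -/
theorem exists_jointDensity_eq (n : ℕ) : ∃ c : ℝ, 0 < c ∧ ∀ x : Fin n → ℝ,
    jointDensity n x = c * ((Matrix.of fun i j : Fin n => hermiteFun i (x j)).det *
      (Matrix.of fun i j : Fin n => hermiteFun i (x j)).det) := by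
  set a : Fin n → ℝ := fun i =>
    (Real.sqrt (2 ^ (i : ℕ) * ((i : ℕ).factorial : ℝ) * Real.sqrt Real.pi))⁻¹ * 2 ^ (i : ℕ)
    with ha
  have ha0 : ∀ i, 0 < a i := fun i => by positivity
  set P : Fin n → ℝ[X] := fun i => C ((2 : ℝ) ^ (i : ℕ))⁻¹ * hermiteH i with hP
  have hdeg : ∀ i, (P i).natDegree = i := fun i => by
    rw [hP, natDegree_C_mul (by positivity), natDegree_hermiteH]
  have hmonic : ∀ i, (P i).Monic := fun i => by
    rw [Monic, leadingCoeff, hdeg, hP, coeff_C_mul, coeff_hermiteH_self,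
      inv_mul_cancel₀ (by positivity)]
  have hdet (x : Fin n → ℝ) : (Matrix.of fun i j : Fin n => hermiteFun i (x j)).det =
      (∏ i, a i) * ((∏ j, Real.exp (-x j ^ 2 / 2)) *
        ∏ i, ∏ j ∈ Finset.Ioi i, (x j - x i)) := by
    rw [← Matrix.det_vandermonde, Matrix.det_eval_matrixOfPolynomials_eq_det_vandermonde x P hdeg
      hmonic, ← Matrix.det_transpose (Matrix.of fun i j => (P j).eval (x i)),
      ← Matrix.det_mul_row, ← Matrix.det_mul_column]
    congr 1
    ext i j
    simp only [Matrix.of_apply, Matrix.transpose_apply, hP, eval_mul, eval_C, hermiteFun, ha]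
    field_simp
  have hpos : 0 < ∏ i, a i := Finset.prod_pos fun i _ => ha0 i
  refine ⟨((∏ i, a i) * ∏ i, a i)⁻¹, by positivity, fun x => ?_⟩
  have he : Real.exp (-∑ i, x i ^ 2) =
      (∏ j, Real.exp (-x j ^ 2 / 2)) * ∏ j, Real.exp (-x j ^ 2 / 2) := by
    rw [← Finset.prod_mul_distrib, ← Finset.sum_neg_distrib, Real.exp_sum]
    refine Finset.prod_congr rfl fun j _ => ?_
    rw [← Real.exp_add]
    ring_nf
  have hv : ∏ i, ∏ j ∈ Finset.Ioi i, |x i - x j| ^ 2 =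
      (∏ i, ∏ j ∈ Finset.Ioi i, (x j - x i)) * ∏ i, ∏ j ∈ Finset.Ioi i, (x j - x i) := by
    simp only [← Finset.prod_mul_distrib]
    refine Finset.prod_congr rfl fun i _ => Finset.prod_congr rfl fun j _ => ?_
    rw [sq_abs]
    ring
  rw [jointDensity, hdet, he, hv]
  field_simp

theorem largestEigenvalueCDF_eq_det {n : ℕ} (hn : 1 ≤ n) (t : ℝ) :
    largestEigenvalueCDF n t = (gramIic n t).det := by
  obtain ⟨c, hc, hd⟩ := exists_jointDensity_eq n
  -- An empty real supremum is `0` by convention; nonemptiness makes the event a product of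
  -- half-lines.
  have : Nonempty (Fin n) := ⟨⟨0, hn⟩⟩
  have hset : {x : Fin n → ℝ | ⨆ i, x i ≤ t} = Set.pi univ fun _ => Iic t := by
    ext x
    simp only [Set.mem_ofPred_eq, Set.mem_pi, mem_univ, true_imp_iff, mem_Iic]
    exact ciSup_le_iff (Set.finite_range x).bddAbove
  have hI (S : Set ℝ) := integral_det_mul_det (μ := volume.restrict S)
    (f := fun i : Fin n => hermiteFun i) (g := fun i : Fin n => hermiteFun i)
    fun i j => (integrable_hermiteFun_mul_hermiteFun i j).integrableOn
  have hi := integrable_det_mul_det (μ := volume)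
    (f := fun i : Fin n => hermiteFun i) (g := fun i : Fin n => hermiteFun i)
    fun i j => integrable_hermiteFun_mul_hermiteFun i j
  rw [← volume_pi] at hi
  have hint : Integrable (jointDensity n) := by
    simp only [funext hd]
    exact hi.const_mul c
  have hnn : ∀ x, 0 ≤ jointDensity n x := fun x => by
    rw [hd]
    exact mul_nonneg hc.le (mul_self_nonneg _)
  have hS : ∫ x in Set.pi univ fun _ => Iic t, jointDensity n x =
      c * (n.factorial * (gramIic n t).det) := by
    simp only [hd]
    rw [integral_const_mul, volume_pi, Measure.restrict_pi_pi, hI, Fintype.card_fin]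
    congr 4
    ext i j
    simp [mul_comm]
  have hZ : ∫ x, jointDensity n x = c * n.factorial := by
    have := hI univ
    simp only [Measure.restrict_univ] at this
    simp only [hd]
    rw [integral_const_mul, volume_pi, this, Fintype.card_fin]
    have h1 : (Matrix.of fun i j : Fin n => ∫ a, hermiteFun j a * hermiteFun i a) = 1 := by
      ext i j
      simp [integral_hermiteFun_mul_hermiteFun, Matrix.one_apply, Fin.ext_iff, eq_comm]
    rw [h1, Matrix.det_one, mul_one]
  have hmeas : MeasurableSet (Set.pi univ fun _ : Fin n => Iic t) :=
    MeasurableSet.univ_pi fun _ => measurableSet_Iic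
  rw [largestEigenvalueCDF, hset, Measure.real, eigenvalueLaw, Measure.smul_apply,
    withDensity_apply _ hmeas, smul_eq_mul,
    ← ofReal_integral_eq_lintegral_ofReal hint (Filter.Eventually.of_forall hnn),
    ← ofReal_integral_eq_lintegral_ofReal hint.integrableOn (Filter.Eventually.of_forall hnn),
    ENNReal.toReal_mul, ENNReal.toReal_inv, ENNReal.toReal_ofReal (integral_nonneg hnn),
    ENNReal.toReal_ofReal (integral_nonneg hnn), hS, hZ]
  have : (n.factorial : ℝ) ≠ 0 := by positivity
  field_simp

/-! ### Nondegeneracy of the Gram matrix -/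

theorem gramIic_apply (n : ℕ) (t : ℝ) (i j : Fin n) :
    gramIic n t i j = ∫ x in Iic t, hermiteFun i x * hermiteFun j x := rfl

theorem gramIic_mulVec (n : ℕ) (t : ℝ) (w : Fin n → ℝ) (i : Fin n) :
    (gramIic n t).mulVec w i = ∫ x in Iic t, hermiteFun i x * ∑ j, w j * hermiteFun j x := by
  simp only [Matrix.mulVec, dotProduct, gramIic_apply, Finset.mul_sum]
  rw [integral_finsetSum]
  · refine Finset.sum_congr rfl fun j _ => ?_
    rw [← integral_mul_const]
    congr 1
    ext x
    ring
  · intro j _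
    refine ((integrable_hermiteFun_mul_hermiteFun i j).integrableOn.const_mul (w j)).congr
      (Filter.Eventually.of_forall fun x => ?_)
    ring

/-- Up to the Gaussian factor the sum is a polynomial with infinitely many roots, hence zero on all
of `ℝ`, where orthonormality recovers each coefficient. -/
theorem sum_hermiteFun_eq_zero {n : ℕ} {w : Fin n → ℝ} {t : ℝ}
    (h : ∀ x < t, ∑ j, w j * hermiteFun j x = 0) : w = 0 := by
  set P : ℝ[X] := ∑ j : Fin n,
    C (w j * (Real.sqrt (2 ^ (j : ℕ) * ((j : ℕ).factorial : ℝ) * Real.sqrt Real.pi))⁻¹) *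
      hermiteH j with hP
  have hev (x : ℝ) : ∑ j, w j * hermiteFun j x = P.eval x * Real.exp (-x ^ 2 / 2) := by
    simp only [hP, eval_finsetSum, eval_mul, eval_C, Finset.sum_mul, hermiteFun, mul_assoc]
  have hP0 : P = 0 := by
    refine Polynomial.eq_zero_of_infinite_isRoot P ((Set.Iio_infinite t).mono fun x hx => ?_)
    have := h x hx
    rw [hev] at this
    exact (mul_eq_zero.1 this).resolve_right (Real.exp_ne_zero _)
  ext k
  have h1 : ∫ x, hermiteFun k x * ∑ j, w j * hermiteFun j x = 0 := by
    simp [hev, hP0]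
  have h2 : ∫ x, hermiteFun k x * ∑ j, w j * hermiteFun j x = w k := by
    simp only [Finset.mul_sum]
    have hcomm (j : Fin n) (x : ℝ) : hermiteFun k x * (w j * hermiteFun j x) =
      w j * (hermiteFun k x * hermiteFun j x) := by ring
    simp only [hcomm]
    rw [integral_finsetSum]
    swap
    · exact fun j _ => (integrable_hermiteFun_mul_hermiteFun k j).const_mul _
    simp [integral_const_mul, integral_hermiteFun_mul_hermiteFun, Fin.ext_iff.symm]
  rw [← h2, h1]
  rfl

/-- A null vector `w` has `w · G w = ∫_{-∞}^t F² = 0` for `F = ∑ w_j φ_j`, so the continuous `F`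
vanishes on `(-∞, t)` and `w = 0`. -/
theorem gramIic_det_ne_zero (n : ℕ) (t : ℝ) : (gramIic n t).det ≠ 0 := by
  intro h0
  obtain ⟨w, hw, hBw⟩ := Matrix.exists_mulVec_eq_zero_iff.2 h0
  refine hw ?_
  set F : ℝ → ℝ := fun x => ∑ j, w j * hermiteFun j x with hF
  have hFc : Continuous F := by
    have := continuous_hermiteFun
    fun_prop
  have hint (i : Fin n) : Integrable (fun x => hermiteFun i x * F x) := by
    simp only [hF, Finset.mul_sum]
    refine integrable_finsetSum _ fun j _ => ?_
    refine ((integrable_hermiteFun_mul_hermiteFun i j).const_mul (w j)).congr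
      (Filter.Eventually.of_forall fun x => ?_)
    ring
  have hFF (x : ℝ) : F x * F x = ∑ i, w i * (hermiteFun i x * F x) := by
    conv_lhs => rw [hF]
    simp only [Finset.sum_mul, mul_assoc, hF]
  have hint2 : Integrable (fun x => F x * F x) := by
    simp only [hFF]
    exact integrable_finsetSum _ fun i _ => (hint i).const_mul _
  have hzero : ∫ x in Iic t, F x * F x = 0 := by
    simp only [hFF]
    rw [integral_finsetSum _ fun i _ => ((hint i).const_mul _).integrableOn]
    refine Finset.sum_eq_zero fun i _ => ?_
    rw [integral_const_mul, ← gramIic_mulVec, hBw]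
    simp
  rw [setIntegral_eq_zero_iff_of_nonneg_ae
    (Filter.Eventually.of_forall fun x => mul_self_nonneg (F x)) hint2.integrableOn] at hzero
  have hopen : F * F =ᵐ[volume.restrict (Iio t)] 0 :=
    ae_restrict_of_ae_restrict_of_subset Iio_subset_Iic_self hzero
  have := Measure.eqOn_open_of_ae_eq hopen isOpen_Iio (hFc.mul hFc).continuousOn continuousOn_const
  exact sum_hermiteFun_eq_zero (t := t) fun x hx => mul_self_eq_zero.1 (this hx)

/-- Nonnegative as a probability, and nonzero. -/
theorem gramIic_det_pos {n : ℕ} (hn : 1 ≤ n) (t : ℝ) : 0 < (gramIic n t).det :=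
  lt_of_le_of_ne (by rw [← largestEigenvalueCDF_eq_det hn]; exact measureReal_nonneg)
    (gramIic_det_ne_zero n t).symm

theorem isUnit_gramIic_det (n : ℕ) (t : ℝ) : IsUnit (gramIic n t).det :=
  isUnit_iff_ne_zero.2 (gramIic_det_ne_zero n t)

/-! ### The inverse of `I - K_n` -/

theorem inner_toL2 (t : ℝ) {f g : ℝ → ℝ} (hf : MemLp f 2 volume) (hg : MemLp g 2 volume) :
    inner ℝ (toL2 t f hf) (toL2 t g hg) = ∫ x in Ioi t, f x * g x := by
  rw [L2.inner_def]
  refine integral_congr_ae ?_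
  filter_upwards [(hf.restrict (Ioi t)).coeFn_toLp, (hg.restrict (Ioi t)).coeFn_toLp] with x h1 h2
  simp [toL2, h1, h2, mul_comm]

/-- The class of `φ_k` in `L²(t, ∞)`. -/
noncomputable def hermiteL2 (t : ℝ) (k : ℕ) : L2Ioi t := toL2 t (hermiteFun k) (memLp_hermiteFun k)

theorem hermiteOp_apply (n : ℕ) (t : ℝ) (f : L2Ioi t) :
    hermiteOp n t f = ∑ k : Fin n, inner ℝ (hermiteL2 t k) f • hermiteL2 t k := by
  rw [← Finset.sum_range (fun k => inner ℝ (hermiteL2 t k) f • hermiteL2 t k)]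
  simp [hermiteOp, hermiteL2]

theorem inner_hermiteL2_sum (n : ℕ) (t : ℝ) (w : Fin n → ℝ) (i : Fin n) :
    inner ℝ (hermiteL2 t i) (∑ k : Fin n, w k • hermiteL2 t k) =
      w i - (gramIic n t).mulVec w i := by
  simp only [inner_sum, inner_smul_right, hermiteL2, inner_toL2, integral_Ioi_hermiteFun_mul,
    ← gramIic_apply, mul_sub, Finset.sum_sub_distrib, Matrix.mulVec, dotProduct]
  congr 1
  · simp [Fin.ext_iff.symm]
  · exact Finset.sum_congr rfl fun j _ => mul_comm _ _

/-- Pairing `(I - K_n) f = g` with each `φ_i` turns it into a linear system with matrix `1 - A(t) =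
G(t)`. -/
theorem gramIic_mulVec_inner {n : ℕ} {t : ℝ} {f g : L2Ioi t} (h : (1 - hermiteOp n t) f = g) :
    (gramIic n t).mulVec (fun i : Fin n => inner ℝ (hermiteL2 t i) f) =
      fun i : Fin n => inner ℝ (hermiteL2 t i) g := by
  ext i
  have h' : g = f - hermiteOp n t f := h.symm
  rw [h', inner_sub_right, hermiteOp_apply, inner_hermiteL2_sum]
  ring

/-- If `(I - K_n) f = 0`, the linear system kills the coefficients of `f`, so `K_n f = 0` and `f =
0`. A preimage of `g` is `g + ∑ w_k φ_k`, with `G w` the coefficient vector of `g`. -/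
theorem isUnit_one_sub_hermiteOp (n : ℕ) (t : ℝ) : IsUnit (1 - hermiteOp n t) := by
  rw [ContinuousLinearMap.isUnit_iff_bijective]
  constructor
  · rw [injective_iff_map_eq_zero]
    intro f hf
    have h1 := gramIic_mulVec_inner hf
    have h2 : (fun i : Fin n => inner ℝ (hermiteL2 t i) f) = 0 := by
      refine Matrix.mulVec_injective_of_isUnit
        ((Matrix.isUnit_iff_isUnit_det _).2 (isUnit_gramIic_det n t)) ?_
      rw [h1, Matrix.mulVec_zero]
      ext i
      simp
    have h3 : f - hermiteOp n t f = 0 := hf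
    rw [hermiteOp_apply] at h3
    have h4 (k : Fin n) : inner ℝ (hermiteL2 t k) f = 0 := congrFun h2 k
    simpa [h4] using h3
  · intro g
    set a : Fin n → ℝ := fun i => inner ℝ (hermiteL2 t i) g with ha
    set w := (gramIic n t)⁻¹.mulVec a with hw
    have hBw : (gramIic n t).mulVec w = a := by
      rw [hw, Matrix.mulVec_mulVec, Matrix.mul_nonsing_inv _ (isUnit_gramIic_det n t),
        Matrix.one_mulVec]
    refine ⟨g + ∑ k : Fin n, w k • hermiteL2 t k, ?_⟩
    change _ - hermiteOp n t _ = g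
    rw [hermiteOp_apply]
    have (k : Fin n) : inner ℝ (hermiteL2 t k) (g + ∑ k : Fin n, w k • hermiteL2 t k) = w k := by
      rw [inner_add_right, inner_hermiteL2_sum, hBw]
      simp [ha]
    simp [this]

theorem invOneSub_eq (n : ℕ) (t : ℝ) {g : ℝ → ℝ} (hg : MemLp g 2 volume) (x : ℝ) :
    invOneSub n t g hg x = g x + hermiteVec n x ⬝ᵥ
      (gramIic n t)⁻¹.mulVec fun i : Fin n => ∫ y in Ioi t, hermiteFun i y * g y := by
  set f := Ring.inverse (1 - hermiteOp n t) (toL2 t g hg) with hf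
  have h : (1 - hermiteOp n t) f = toL2 t g hg :=
    congrArg (fun T : L2Ioi t →L[ℝ] L2Ioi t => T (toL2 t g hg))
      (Ring.mul_inverse_cancel _ (isUnit_one_sub_hermiteOp n t))
  have hw := gramIic_mulVec_inner h
  have hin (i : Fin n) : inner ℝ (hermiteL2 t i) (toL2 t g hg) =
      ∫ y in Ioi t, hermiteFun i y * g y := inner_toL2 t _ hg
  have hin' (i : Fin n) : inner ℝ (hermiteL2 t i) f = ∫ y in Ioi t, hermiteFun i y * f y := by
    rw [L2.inner_def]
    refine integral_congr_ae ?_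
    filter_upwards [((memLp_hermiteFun i).restrict (Ioi t)).coeFn_toLp] with y hy
    simp [hermiteL2, toL2, hy, mul_comm]
  simp only [hin, hin'] at hw
  rw [invOneSub, ← hf, integral_hermiteKernel_mul, ← hw, Matrix.mulVec_mulVec,
    Matrix.nonsing_inv_mul _ (isUnit_gramIic_det n t), Matrix.one_mulVec, Finset.sum_range,
    dotProduct]
  congr 1
  exact Finset.sum_congr rfl fun k _ => mul_comm _ _

/-- The vector `(∫_{-∞}^t φ_k φ_n)_{k < n}`. -/
noncomputable def overlapIic (n : ℕ) (t : ℝ) : Fin n → ℝ :=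
  fun k => ∫ x in Iic t, hermiteFun k x * hermiteFun n x

theorem q_eq (n : ℕ) (t : ℝ) : q n t = ((n : ℝ) / 2) ^ ((1 : ℝ) / 4) *
    (hermiteFun n t - hermiteVec n t ⬝ᵥ (gramIic n t)⁻¹.mulVec (overlapIic n t)) := by
  rw [q, bigQ, invOneSub_eq]
  -- `φ_n` is orthogonal on `ℝ` to every `φ_i` with `i < n`, so the integrals over the two
  -- half-lines are opposite.
  have : (fun i : Fin n => ∫ y in Ioi t, hermiteFun i y * phi n y) =
      -(((n : ℝ) / 2) ^ ((1 : ℝ) / 4)) • overlapIic n t := by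
    ext i
    simp only [phi, mul_left_comm (hermiteFun i _), integral_const_mul]
    rw [integral_Ioi_hermiteFun_mul, if_neg i.2.ne]
    simp [overlapIic]
  rw [this, phi, Matrix.mulVec_smul, dotProduct_smul]
  simp
  ring

/-- Here `φ_{n-1}` lies in the span: the right-hand side is `e - G e`, and the `-e` in `G⁻¹(e - G e)
= G⁻¹e - e` cancels the free term. -/
theorem p_eq (m : ℕ) (t : ℝ) : p (m + 1) t = (((m + 1 : ℕ) : ℝ) / 2) ^ ((1 : ℝ) / 4) *
    (hermiteVec (m + 1) t ⬝ᵥ (gramIic (m + 1) t)⁻¹.mulVec (Pi.single (Fin.last m) 1)) := by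
  rw [p, bigP, invOneSub_eq]
  set r := (((m + 1 : ℕ) : ℝ) / 2) ^ ((1 : ℝ) / 4) with hr
  set e : Fin (m + 1) → ℝ := Pi.single (Fin.last m) 1 with he
  have : (fun i : Fin (m + 1) => ∫ y in Ioi t, hermiteFun i y * psi (m + 1) y) =
      r • (e - (gramIic (m + 1) t).mulVec e) := by
    ext i
    simp only [psi, ← hr, mul_left_comm (hermiteFun i _), integral_const_mul]
    rw [Nat.add_sub_cancel, integral_Ioi_hermiteFun_mul]
    simp [he, Matrix.mulVec_single, gramIic_apply, Pi.single_apply, Fin.ext_iff]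
  rw [this, Matrix.mulVec_smul, Matrix.mulVec_sub, Matrix.mulVec_mulVec,
    Matrix.nonsing_inv_mul _ (isUnit_gramIic_det _ t), Matrix.one_mulVec, dotProduct_smul,
    dotProduct_sub]
  have h1 : hermiteVec (m + 1) t ⬝ᵥ e = hermiteFun m t := by simp [he, hermiteVec]
  rw [h1, psi, ← hr, Nat.add_sub_cancel, smul_eq_mul]
  ring

/-! ### Derivatives of determinants and inverses of matrices -/

section MatrixDeriv

open Matrix

variable {ι : Type*} [Fintype ι]

theorem dotProduct_mulVec_comm_of_symm {C : Matrix ι ι ℝ} (hC : Cᵀ = C) (x y : ι → ℝ) :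
    x ⬝ᵥ C *ᵥ y = y ⬝ᵥ C *ᵥ x := by
  rw [dotProduct_mulVec, ← mulVec_transpose, hC, dotProduct_comm]

variable [DecidableEq ι] {B : ℝ → Matrix ι ι ℝ} {B' : Matrix ι ι ℝ} {t : ℝ}

theorem hasDerivAt_det (h : ∀ i j, HasDerivAt (fun s => B s i j) (B' i j) t) :
    HasDerivAt (fun s => (B s).det) (∑ i, (B t).cramer (fun k => B' k i) i) t := by
  simp only [Matrix.det_apply']
  have h1 (σ : Equiv.Perm ι) := (HasDerivAt.fun_finsetProd (u := Finset.univ)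
    fun i _ => h (σ i) i).const_mul ((Equiv.Perm.sign σ : ℤ) : ℝ)
  refine (HasDerivAt.fun_sum fun σ _ => h1 σ).congr_deriv ?_
  simp only [cramer_apply, Matrix.det_apply']
  rw [Finset.sum_comm]
  refine Finset.sum_congr rfl fun σ _ => ?_
  rw [Finset.mul_sum]
  refine Finset.sum_congr rfl fun i _ => ?_
  rw [← Finset.mul_prod_erase _ _ (Finset.mem_univ i), updateCol_self, smul_eq_mul, mul_comm (B' _ _)]
  congr 2
  refine Finset.prod_congr rfl fun j hj => ?_
  rw [updateCol_ne (Finset.ne_of_mem_erase hj)]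

/-- Jacobi's formula: the trace of `adj(B) v vᵀ` is `det B` times the quadratic form of `B⁻¹` at
`v`. -/
theorem hasDerivAt_det_of_rank_one {v : ι → ℝ}
    (h : ∀ i j, HasDerivAt (fun s => B s i j) (v i * v j) t) (hB : IsUnit (B t).det) :
    HasDerivAt (fun s => (B s).det) ((v ⬝ᵥ (B t)⁻¹ *ᵥ v) * (B t).det) t := by
  refine (hasDerivAt_det (B' := Matrix.vecMulVec v v) h).congr_deriv ?_
  have h1 : (B t).adjugate = (B t).det • (B t)⁻¹ := by
    rw [inv_def, smul_smul, Ring.mul_inverse_cancel _ hB, one_smul]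
  have h2 (i : ι) : (fun k => vecMulVec v v k i) = v i • v := by
    ext k
    simp [vecMulVec_apply, mul_comm]
  simp only [h2, map_smul, Pi.smul_apply, smul_eq_mul]
  rw [cramer_eq_adjugate_mulVec, h1, smul_mulVec, dotProduct, Finset.sum_mul]
  refine Finset.sum_congr rfl fun i _ => ?_
  rw [Pi.smul_apply, smul_eq_mul]
  ring

theorem tendsto_inv {l : Filter ℝ} {A : Matrix ι ι ℝ} (h : Filter.Tendsto B l (nhds A))
    (hA : IsUnit A.det) : Filter.Tendsto (fun s => (B s)⁻¹) l (nhds A⁻¹) := by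
  simp only [inv_def, Ring.inverse_eq_inv']
  refine Filter.Tendsto.smul ?_ ?_
  · exact ((Continuous.matrix_det continuous_id).continuousAt.tendsto.comp h).inv₀ hA.ne_zero
  · exact (Continuous.matrix_adjugate continuous_id).continuousAt.tendsto.comp h

/-- Pass to the entrywise limit in `B_s⁻¹ - B_t⁻¹ = -B_s⁻¹ (B_s - B_t) B_t⁻¹`, divided by `s - t`.
-/
theorem hasDerivAt_inv (h : ∀ i j, HasDerivAt (fun s => B s i j) (B' i j) t)
    (hB : ∀ s, IsUnit (B s).det) (i j : ι) :
    HasDerivAt (fun s => (B s)⁻¹ i j) (-((B t)⁻¹ * B' * (B t)⁻¹) i j) t := by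
  have hc : Filter.Tendsto B (nhds t) (nhds (B t)) :=
    tendsto_pi_nhds.2 fun i => tendsto_pi_nhds.2 fun j => (h i j).continuousAt.tendsto
  have hCt := (tendsto_inv hc (hB t)).mono_left (nhdsWithin_le_nhds (s := {t}ᶜ))
  have hs : Filter.Tendsto (fun s => (s - t)⁻¹ • (B s - B t)) (nhdsWithin t {t}ᶜ) (nhds B') :=
    tendsto_pi_nhds.2 fun i => tendsto_pi_nhds.2 fun j => hasDerivAt_iff_tendsto_slope.1 (h i j)
  rw [hasDerivAt_iff_tendsto_slope]
  have hlim := (((hCt.mul hs).mul_const (B t)⁻¹).neg)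
  refine (tendsto_pi_nhds.1 (tendsto_pi_nhds.1 hlim i) j).congr fun s => ?_
  have key : -((B s)⁻¹ * ((s - t)⁻¹ • (B s - B t)) * (B t)⁻¹) =
      (s - t)⁻¹ • ((B s)⁻¹ - (B t)⁻¹) := by
    rw [mul_smul_comm, smul_mul_assoc, ← smul_neg, mul_sub, sub_mul,
      nonsing_inv_mul _ (hB s), one_mul, mul_assoc, mul_nonsing_inv _ (hB t), mul_one, neg_sub]
  exact congrFun (congrFun key i) j

theorem hasDerivAt_dotProduct_inv_mulVec {v : ℝ → ι → ℝ} {v' : ι → ℝ}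
    (hv : ∀ i, HasDerivAt (fun s => v s i) (v' i) t)
    (h : ∀ i j, HasDerivAt (fun s => B s i j) (v t i * v t j) t)
    (hB : ∀ s, IsUnit (B s).det) (hsymm : (B t)ᵀ = B t) :
    HasDerivAt (fun s => v s ⬝ᵥ (B s)⁻¹ *ᵥ v s)
      (2 * (v' ⬝ᵥ (B t)⁻¹ *ᵥ v t) - (v t ⬝ᵥ (B t)⁻¹ *ᵥ v t) ^ 2) t := by
  have hC : ((B t)⁻¹)ᵀ = (B t)⁻¹ := by rw [transpose_nonsing_inv, hsymm]
  have hinv := hasDerivAt_inv (B' := vecMulVec (v t) (v t)) h hB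
  have hd : HasDerivAt (fun s => v s ⬝ᵥ (B s)⁻¹ *ᵥ v s)
      (v' ⬝ᵥ (B t)⁻¹ *ᵥ v t + v t ⬝ᵥ ((-((B t)⁻¹ * vecMulVec (v t) (v t) * (B t)⁻¹)) *ᵥ v t +
        (B t)⁻¹ *ᵥ v')) t := by
    simp only [dotProduct, mulVec]
    refine (HasDerivAt.fun_sum fun i _ => (hv i).mul
      (HasDerivAt.fun_sum fun j _ => (hinv i j).mul (hv j))).congr_deriv ?_
    simp only [Finset.sum_add_distrib, Pi.add_apply, Pi.mul_apply, Matrix.neg_apply, mulVec,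
      dotProduct]
  refine hd.congr_deriv ?_
  rw [dotProduct_add, dotProduct_mulVec_comm_of_symm hC (v t) v', neg_mulVec, dotProduct_neg,
    ← mulVec_mulVec, ← mulVec_mulVec, vecMulVec_mulVec]
  simp [mulVec_smul, dotProduct_smul]
  ring

/-- The algebraic identity behind the second logarithmic derivative: a commutator relation for `B`
turns the quadratic form of `B⁻¹` into a product. -/
theorem quadratic_form_identity {B M : Matrix ι ι ℝ} {v e c : ι → ℝ} {s f : ℝ}
    (hB : IsUnit B.det) (hsymm : Bᵀ = B) (hM : Mᵀ = -M)
    (hcomm : vecMulVec v v = M * B - B * M - s • (vecMulVec e c + vecMulVec c e)) :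
    2 * ((M *ᵥ v - (s * f) • e) ⬝ᵥ B⁻¹ *ᵥ v) - (v ⬝ᵥ B⁻¹ *ᵥ v) ^ 2 =
      -2 * (s * ((f - v ⬝ᵥ B⁻¹ *ᵥ c) * (v ⬝ᵥ B⁻¹ *ᵥ e))) := by
  have hC : (B⁻¹)ᵀ = B⁻¹ := by rw [transpose_nonsing_inv, hsymm]
  rw [dotProduct_mulVec_comm_of_symm hC v c, dotProduct_mulVec_comm_of_symm hC v e]
  set y := B⁻¹ *ᵥ v with hy
  have hBy : B *ᵥ y = v := by rw [hy, mulVec_mulVec, mul_nonsing_inv _ hB, one_mulVec]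
  -- At `y = B⁻¹v` the left side becomes `(v · B⁻¹v)²`; antisymmetry of `M` merges the two
  -- commutator terms into `2 y · M v`.
  have h1 := congrArg (fun N : Matrix ι ι ℝ => y ⬝ᵥ N *ᵥ y) hcomm
  simp only [sub_mulVec, smul_mulVec, add_mulVec, ← mulVec_mulVec, vecMulVec_mulVec, hBy,
    dotProduct_sub, dotProduct_smul, dotProduct_add, op_smul_eq_smul, smul_eq_mul] at h1
  have h2 : y ⬝ᵥ B *ᵥ M *ᵥ y = -(y ⬝ᵥ M *ᵥ v) := by
    rw [dotProduct_mulVec_comm_of_symm hsymm, hBy, dotProduct_comm, dotProduct_mulVec,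
      ← mulVec_transpose, hM, neg_mulVec, neg_dotProduct, dotProduct_comm]
  rw [h2] at h1
  rw [sub_dotProduct, smul_dotProduct, smul_eq_mul, dotProduct_comm (M *ᵥ v), dotProduct_comm v y,
    dotProduct_comm e y, dotProduct_comm c y]
  rw [dotProduct_comm v y, dotProduct_comm c y, dotProduct_comm e y] at h1
  linear_combination -h1

end MatrixDeriv

/-! ### The commutator relation for the Gram matrix -/

open Matrix in
theorem gramIic_transpose (n : ℕ) (t : ℝ) : (gramIic n t)ᵀ = gramIic n t := by
  ext i j
  simp [gramIic, mul_comm]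

theorem hasDerivAt_integral_Iic {f : ℝ → ℝ} (hf : Continuous f) (hi : Integrable f) (t : ℝ) :
    HasDerivAt (fun s => ∫ x in Iic s, f x) (f t) t := by
  have h (s : ℝ) : ∫ x in Iic s, f x = (∫ x in Iic 0, f x) + ∫ x in (0 : ℝ)..s, f x := by
    rw [← intervalIntegral.integral_Iic_sub_Iic hi.integrableOn hi.integrableOn]
    ring
  rw [funext h]
  exact (hf.integral_hasStrictDerivAt 0 t).hasDerivAt.const_add _

theorem hasDerivAt_integral_Iic_hermiteFun (j k : ℕ) (t : ℝ) :
    HasDerivAt (fun s => ∫ x in Iic s, hermiteFun j x * hermiteFun k x)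
      (hermiteFun j t * hermiteFun k t) t :=
  hasDerivAt_integral_Iic ((continuous_hermiteFun j).mul (continuous_hermiteFun k))
    (integrable_hermiteFun_mul_hermiteFun j k) t

/-- The matrix of `d/dx` compressed to the span of `φ_0, …, φ_{n-1}`. -/
noncomputable def ladderMatrix (n : ℕ) : Matrix (Fin n) (Fin n) ℝ :=
  Matrix.of fun i j => (if (j : ℕ) + 1 = i then ladder i else 0) -
    if (i : ℕ) + 1 = j then ladder j else 0

open Matrix in
theorem ladderMatrix_transpose (n : ℕ) : (ladderMatrix n)ᵀ = -ladderMatrix n := by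
  ext i j
  simp [ladderMatrix]

/-- Differentiation leaves the span only in the last row, through `φ_{m+1}`; this is the source of
the term in `e`. -/
theorem ladderMatrix_mulVec (m : ℕ) (x : ℝ) (i : Fin (m + 1)) :
    ladder i * hermiteFun (i - 1) x - ladder (i + 1) * hermiteFun (i + 1) x =
      ((ladderMatrix (m + 1)).mulVec (hermiteVec (m + 1) x) -
        (ladder (m + 1) * hermiteFun (m + 1) x) • Pi.single (Fin.last m) 1 : Fin (m + 1) → ℝ) i := by
  have h1 : ∑ j : Fin (m + 1), (if (j : ℕ) + 1 = i then ladder i else 0) * hermiteFun j x =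
      ladder i * hermiteFun (i - 1) x := by
    rw [← Finset.sum_range (fun j => (if j + 1 = (i : ℕ) then ladder i else 0) * hermiteFun j x)]
    rcases h : (i : ℕ) with _ | k
    · simp [ladder]
    · have : k < m + 1 := by lia
      simp [this]
  have h2 : ∑ j : Fin (m + 1), (if (i : ℕ) + 1 = j then ladder j else 0) * hermiteFun j x =
      ladder (i + 1) * hermiteFun (i + 1) x -
        (ladder (m + 1) * hermiteFun (m + 1) x) * (Pi.single (Fin.last m) 1 : Fin (m + 1) → ℝ) i := by
    rw [← Finset.sum_range (fun j => (if (i : ℕ) + 1 = j then ladder j else 0) * hermiteFun j x)]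
    by_cases h : (i : ℕ) = m
    · have : i = Fin.last m := Fin.ext h
      subst this
      simp
    · have h3 : (i : ℕ) + 1 < m + 1 := by lia
      have h4 : i ≠ Fin.last m := fun h5 => h (congrArg Fin.val h5)
      simp only [ite_mul, zero_mul, Finset.sum_ite_eq, Finset.mem_range, h3, if_true,
        Pi.single_apply, h4, if_false]
      ring
  simp only [Pi.sub_apply, Pi.smul_apply, smul_eq_mul, Matrix.mulVec, dotProduct, ladderMatrix,
    Matrix.of_apply, hermiteVec, sub_mul, Finset.sum_sub_distrib, h1, h2]
  ring

theorem hasDerivAt_hermiteVec (m : ℕ) (x : ℝ) (i : Fin (m + 1)) :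
    HasDerivAt (fun s => hermiteVec (m + 1) s i)
      (((ladderMatrix (m + 1)).mulVec (hermiteVec (m + 1) x) -
        (ladder (m + 1) * hermiteFun (m + 1) x) • Pi.single (Fin.last m) 1 : Fin (m + 1) → ℝ) i)
      x :=
  (hasDerivAt_hermiteFun i x).congr_deriv (ladderMatrix_mulVec m x i)

-- Integrate `(φ_i φ_j)'` over `(-∞, t]`: the boundary value is `φ_i(t) φ_j(t)`, the ladder matrix
-- produces the commutator, and the leakage to `φ_{m+1}` produces the overlaps.
open Matrix in
theorem gramIic_commutator (m : ℕ) (t : ℝ) :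
    vecMulVec (hermiteVec (m + 1) t) (hermiteVec (m + 1) t) =
      ladderMatrix (m + 1) * gramIic (m + 1) t - gramIic (m + 1) t * ladderMatrix (m + 1) -
        ladder (m + 1) • (vecMulVec (Pi.single (Fin.last m) 1) (overlapIic (m + 1) t) +
          vecMulVec (overlapIic (m + 1) t) (Pi.single (Fin.last m) 1)) := by
  set M := ladderMatrix (m + 1) with hM
  set e : Fin (m + 1) → ℝ := Pi.single (Fin.last m) 1 with he
  set s := ladder (m + 1) with hs
  have hMt (j k : Fin (m + 1)) : M j k = -M k j := by
    have := congrFun (congrFun (ladderMatrix_transpose (m + 1)) k) j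
    simpa [← hM] using this
  ext i j
  set F : ℝ → ℝ := fun x => hermiteFun i x * hermiteFun j x with hF
  set F' : ℝ → ℝ := fun x =>
    (∑ k, M i k * (hermiteFun k x * hermiteFun j x)) -
      (∑ k, M k j * (hermiteFun i x * hermiteFun k x)) -
      (s * e i * (hermiteFun j x * hermiteFun (m + 1) x) +
        s * e j * (hermiteFun i x * hermiteFun (m + 1) x)) with hF'
  have hder (x : ℝ) : HasDerivAt F (F' x) x := by
    refine ((hasDerivAt_hermiteVec m x i).mul (hasDerivAt_hermiteVec m x j)).congr_deriv ?_
    simp only [← hM, ← he, ← hs, Pi.sub_apply, Pi.smul_apply, smul_eq_mul, mulVec, dotProduct,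
      hermiteVec, hF', hMt j, sub_mul, mul_sub, Finset.sum_mul, Finset.mul_sum]
    have e1 : ∑ k : Fin (m + 1), M i k * hermiteFun k x * hermiteFun j x =
      ∑ k : Fin (m + 1), M i k * (hermiteFun k x * hermiteFun j x) :=
      Finset.sum_congr rfl fun k _ => by ring
    have e2 : ∑ k : Fin (m + 1), hermiteFun i x * (-M k j * hermiteFun k x) =
      -∑ k : Fin (m + 1), M k j * (hermiteFun i x * hermiteFun k x) := by
      rw [← Finset.sum_neg_distrib]
      exact Finset.sum_congr rfl fun k _ => by ring
    rw [e1, e2]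
    ring
  have hi := integrable_hermiteFun_mul_hermiteFun
  have hI1 : Integrable fun x => ∑ k : Fin (m + 1), M i k * (hermiteFun k x * hermiteFun j x) :=
    integrable_finsetSum _ fun k _ => (hi k j).const_mul _
  have hI2 : Integrable fun x => ∑ k : Fin (m + 1), M k j * (hermiteFun i x * hermiteFun k x) :=
    integrable_finsetSum _ fun k _ => (hi i k).const_mul _
  have hI3 := (hi j (m + 1)).const_mul (s * e i)
  have hI4 := (hi i (m + 1)).const_mul (s * e j)
  have hI12 : Integrable fun x =>
      (∑ k : Fin (m + 1), M i k * (hermiteFun k x * hermiteFun j x)) -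
        ∑ k : Fin (m + 1), M k j * (hermiteFun i x * hermiteFun k x) := hI1.sub hI2
  have hI34 : Integrable fun x => s * e i * (hermiteFun j x * hermiteFun (m + 1) x) +
      s * e j * (hermiteFun i x * hermiteFun (m + 1) x) := hI3.add hI4
  have hF'i : Integrable F' := hI12.sub hI34
  -- An integrable function with integrable derivative tends to `0` at `-∞`.
  have hbot := tendsto_zero_of_hasDerivAt_of_integrableOn_Iic (a := t) (fun x _ => hder x)
    hF'i.integrableOn (hi i j).integrableOn
  have hint := integral_Iic_of_hasDerivAt_of_tendsto' (a := t) (fun x _ => hder x)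
    hF'i.integrableOn hbot
  have hval : ∫ x in Iic t, F' x = (∑ k, M i k * gramIic (m + 1) t k j) -
      (∑ k, M k j * gramIic (m + 1) t i k) -
      (s * e i * overlapIic (m + 1) t j + s * e j * overlapIic (m + 1) t i) := by
    simp only [hF']
    rw [integral_sub hI12.integrableOn hI34.integrableOn,
      integral_sub hI1.integrableOn hI2.integrableOn,
      integral_add hI3.integrableOn hI4.integrableOn,
      integral_finsetSum, integral_finsetSum]
    · simp only [integral_const_mul, gramIic_apply, overlapIic]
    · exact fun k _ => ((hi i k).const_mul _).integrableOn
    · exact fun k _ => ((hi k j).const_mul _).integrableOn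
  rw [hval, sub_zero] at hint
  simp only [vecMulVec_apply, Matrix.sub_apply, Matrix.smul_apply, Matrix.add_apply,
    Matrix.mul_apply, smul_eq_mul]
  have e3 : ∑ k, gramIic (m + 1) t i k * M k j = ∑ k, M k j * gramIic (m + 1) t i k :=
    Finset.sum_congr rfl fun k _ => mul_comm _ _
  rw [e3]
  simp only [hF] at hint
  simp only [hermiteVec]
  linear_combination -hint

/-! ### Logarithmic derivatives of the determinant -/

/-- The value `R(t, t)` of the resolvent kernel, which is the logarithmic derivative of
`det (gramIic n t)`. -/
noncomputable def resolventDiag (n : ℕ) (t : ℝ) : ℝ :=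
  hermiteVec n t ⬝ᵥ (gramIic n t)⁻¹.mulVec (hermiteVec n t)

theorem hasDerivAt_gramIic_apply (n : ℕ) (t : ℝ) (i j : Fin n) :
    HasDerivAt (fun s => gramIic n s i j) (hermiteVec n t i * hermiteVec n t j) t :=
  hasDerivAt_integral_Iic_hermiteFun i j t

theorem hasDerivAt_log_det_gramIic (n : ℕ) (t : ℝ) :
    HasDerivAt (fun s => Real.log (gramIic n s).det) (resolventDiag n t) t := by
  have h := (hasDerivAt_det_of_rank_one (hasDerivAt_gramIic_apply n t)
    (isUnit_gramIic_det n t)).log (gramIic_det_ne_zero n t)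
  rwa [mul_div_cancel_right₀ _ (gramIic_det_ne_zero n t)] at h

theorem hasDerivAt_resolventDiag {n : ℕ} (hn : 1 ≤ n) (t : ℝ) :
    HasDerivAt (resolventDiag n) (-2 * (q n t * p n t)) t := by
  obtain ⟨m, rfl⟩ : ∃ m, n = m + 1 := ⟨n - 1, by lia⟩
  refine (hasDerivAt_dotProduct_inv_mulVec (hasDerivAt_hermiteVec m t)
    (hasDerivAt_gramIic_apply (m + 1) t) (isUnit_gramIic_det (m + 1))
    (gramIic_transpose (m + 1) t)).congr_deriv ?_
  rw [quadratic_form_identity (isUnit_gramIic_det (m + 1) t) (gramIic_transpose (m + 1) t)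
    (ladderMatrix_transpose (m + 1)) (gramIic_commutator m t), q_eq, p_eq]
  -- The factor `√(n/2)` splits evenly into the `(n/2)^{1/4}` of `q_n` and that of `p_n`.
  have hr : ladder (m + 1) = (((m + 1 : ℕ) : ℝ) / 2) ^ ((1 : ℝ) / 4) *
      (((m + 1 : ℕ) : ℝ) / 2) ^ ((1 : ℝ) / 4) := by
    rw [← Real.rpow_add (by positivity), ladder, Real.sqrt_eq_rpow]
    norm_num
  rw [hr]
  ring

/-! ### Behaviour at `+∞` -/

theorem tendsto_gramIic_atTop (n : ℕ) : Filter.Tendsto (gramIic n) Filter.atTop (nhds 1) := by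
  refine tendsto_pi_nhds.2 fun i => tendsto_pi_nhds.2 fun j => ?_
  have h := (aecover_Iic (μ := volume) Filter.tendsto_id).integral_tendsto_of_countably_generated
    (integrable_hermiteFun_mul_hermiteFun i j)
  rw [integral_hermiteFun_mul_hermiteFun] at h
  simpa [Matrix.one_apply, Fin.ext_iff, gramIic_apply] using h

theorem gramIic_inv_isBigO_one (n : ℕ) (i j : Fin n) :
    (fun t => (gramIic n t)⁻¹ i j) =O[Filter.atTop] fun _ => (1 : ℝ) := by
  have h := tendsto_inv (tendsto_gramIic_atTop n) (by simp)
  exact (tendsto_pi_nhds.1 (tendsto_pi_nhds.1 h i) j).isBigO_one ℝ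

theorem overlapIic_isBigO_one (n : ℕ) (i : Fin n) :
    (fun t => overlapIic n t i) =O[Filter.atTop] fun _ => (1 : ℝ) :=
  ((aecover_Iic (μ := volume) Filter.tendsto_id).integral_tendsto_of_countably_generated
    (integrable_hermiteFun_mul_hermiteFun i n)).isBigO_one ℝ

/-- `G(t)⁻¹` stays bounded because `G(t) → 1`, so the decay of the `φ_i` survives. -/
theorem hermiteVec_dotProduct_isBigO {n : ℕ} {w : ℝ → Fin n → ℝ}
    (hw : ∀ i, (fun t => w t i) =O[Filter.atTop] fun _ => (1 : ℝ)) :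
    (fun t => hermiteVec n t ⬝ᵥ (gramIic n t)⁻¹.mulVec (w t)) =O[Filter.atTop]
      fun t => Real.exp (-(2 * t)) := by
  simp only [dotProduct, Matrix.mulVec, hermiteVec]
  refine Asymptotics.IsBigO.fun_sum fun i _ => ?_
  have h1 : (fun t => ∑ j, (gramIic n t)⁻¹ i j * w t j) =O[Filter.atTop] fun _ => (1 : ℝ) :=
    Asymptotics.IsBigO.fun_sum fun j _ => by
      simpa using (gramIic_inv_isBigO_one n i j).mul (hw j)
  simpa using (hermiteFun_isBigO_atTop i).mul h1

theorem exp_neg_two_mul_isBigO_one :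
    (fun t : ℝ => Real.exp (-(2 * t))) =O[Filter.atTop] fun _ => (1 : ℝ) := by
  refine Filter.Tendsto.isBigO_one ℝ (c := 0) (Real.tendsto_exp_neg_atTop_nhds_zero.comp ?_)
  exact Filter.tendsto_id.const_mul_atTop two_pos

theorem resolventDiag_isBigO (n : ℕ) :
    resolventDiag n =O[Filter.atTop] fun t => Real.exp (-(2 * t)) :=
  hermiteVec_dotProduct_isBigO fun i =>
    (hermiteFun_isBigO_atTop i).trans exp_neg_two_mul_isBigO_one

theorem q_isBigO (n : ℕ) : q n =O[Filter.atTop] fun t => Real.exp (-(2 * t)) := by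
  simp only [funext (q_eq n)]
  exact ((hermiteFun_isBigO_atTop n).sub
    (hermiteVec_dotProduct_isBigO (overlapIic_isBigO_one n))).const_mul_left _

theorem p_isBigO {n : ℕ} (hn : 1 ≤ n) : p n =O[Filter.atTop] fun t => Real.exp (-(2 * t)) := by
  obtain ⟨m, rfl⟩ : ∃ m, n = m + 1 := ⟨n - 1, by lia⟩
  simp only [funext (p_eq m)]
  exact (hermiteVec_dotProduct_isBigO (w := fun _ => Pi.single (Fin.last m) 1) fun i =>
    Asymptotics.isBigO_const_const _ one_ne_zero _).const_mul_left _

theorem sub_const_isBigO_exp (t : ℝ) :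
    (fun x : ℝ => x - t) =O[Filter.atTop] fun x => Real.exp x := by
  have h := (X - C t : ℝ[X]).tendsto_div_exp_atTop
  simp only [eval_sub, eval_X, eval_C] at h
  exact (Asymptotics.isLittleO_of_tendsto (fun x hx => absurd hx (Real.exp_ne_zero x)) h).isBigO

theorem tendsto_sub_mul_resolventDiag (n : ℕ) (t : ℝ) :
    Filter.Tendsto (fun x => (x - t) * resolventDiag n x) Filter.atTop (nhds 0) := by
  refine ((sub_const_isBigO_exp t).mul (resolventDiag_isBigO n)).trans_tendsto ?_
  refine Real.tendsto_exp_neg_atTop_nhds_zero.congr fun x => ?_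
  rw [← Real.exp_add]
  ring_nf

theorem continuous_gramIic_inv_apply (n : ℕ) (i j : Fin n) :
    Continuous fun t => (gramIic n t)⁻¹ i j :=
  continuous_iff_continuousAt.2 fun t => (hasDerivAt_inv (B' := Matrix.vecMulVec _ _)
    (hasDerivAt_gramIic_apply n t) (isUnit_gramIic_det n) i j).continuousAt

theorem continuous_hermiteVec_dotProduct {n : ℕ} {w : ℝ → Fin n → ℝ}
    (hw : ∀ i, Continuous fun t => w t i) :
    Continuous fun t => hermiteVec n t ⬝ᵥ (gramIic n t)⁻¹.mulVec (w t) := by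
  simp only [dotProduct, Matrix.mulVec, hermiteVec]
  exact continuous_finsetSum _ fun i _ => (continuous_hermiteFun i).mul
    (continuous_finsetSum _ fun j _ => (continuous_gramIic_inv_apply n i j).mul (hw j))

theorem continuous_q (n : ℕ) : Continuous (q n) := by
  simp only [funext (q_eq n)]
  refine ((continuous_hermiteFun n).sub (continuous_hermiteVec_dotProduct fun i => ?_)).const_mul _
  exact continuous_iff_continuousAt.2 fun t =>
    (hasDerivAt_integral_Iic_hermiteFun i n t).continuousAt

theorem continuous_p {n : ℕ} (hn : 1 ≤ n) : Continuous (p n) := by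
  obtain ⟨m, rfl⟩ : ∃ m, n = m + 1 := ⟨n - 1, by lia⟩
  simp only [funext (p_eq m)]
  exact (continuous_hermiteVec_dotProduct (w := fun _ => Pi.single (Fin.last m) 1)
    fun i => continuous_const).const_mul _

theorem integrableOn_sub_mul_q_mul_p {n : ℕ} (hn : 1 ≤ n) (t : ℝ) :
    IntegrableOn (fun x => (x - t) * (q n x * p n x)) (Ioi t) := by
  -- Growth `eˣ` from `x - t` against `e^{-2x}` from each of `q_n` and `p_n`.
  refine integrable_of_isBigO_exp_neg (b := 3) (by norm_num) ?_ ?_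
  · have h1 := continuous_q n
    have h2 := continuous_p hn
    fun_prop
  · refine ((sub_const_isBigO_exp t).mul ((q_isBigO n).mul (p_isBigO hn))).congr_right fun x => ?_
    rw [← Real.exp_add, ← Real.exp_add]
    ring_nf

/-- Both integrations are done at once: `(x - t) R - log det G` has derivative `(x - t) R'`,
vanishes at `+∞`, and equals `-log det G(t)` at `x = t`. -/
theorem log_det_gramIic_eq_integral {n : ℕ} (hn : 1 ≤ n) (t : ℝ) :
    Real.log (gramIic n t).det = -2 * ∫ x in Ioi t, (x - t) * (q n x * p n x) := by
  have hder (x : ℝ) : HasDerivAt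
      (fun y => (y - t) * resolventDiag n y - Real.log (gramIic n y).det)
      (-2 * ((x - t) * (q n x * p n x))) x := by
    refine ((((hasDerivAt_id x).sub_const t).mul (hasDerivAt_resolventDiag hn x)).sub
      (hasDerivAt_log_det_gramIic n x)).congr_deriv ?_
    simp
    ring
  have hlog : Filter.Tendsto (fun y => Real.log (gramIic n y).det) Filter.atTop (nhds 0) := by
    have h := ((Continuous.matrix_det continuous_id).continuousAt.tendsto.comp
      (tendsto_gramIic_atTop n)).log (by simp)
    simpa using h
  have h := integral_Ioi_of_hasDerivAt_of_tendsto' (a := t) (fun x _ => hder x)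
    ((integrableOn_sub_mul_q_mul_p hn t).const_mul _)
    ((tendsto_sub_mul_resolventDiag n t).sub hlog)
  rw [integral_const_mul] at h
  rw [h]
  simp

end GUE

theorem theorem4 (n : ℕ) (hn : 1 ≤ n) :
    (∀ x : ℝ, IsUnit (1 - GUE.hermiteOp n x)) ∧
      ∀ t : ℝ,
        GUE.HasFredholmDet (GUE.hermiteKernel n)
            ((MeasureTheory.volume : MeasureTheory.Measure ℝ).restrict (Set.Ioi t))
            (GUE.largestEigenvalueCDF n t) ∧
          MeasureTheory.IntegrableOn (fun x => (x - t) * (GUE.q n x * GUE.p n x)) (Set.Ioi t) ∧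
          GUE.largestEigenvalueCDF n t =
            Real.exp (-2 * ∫ x in Set.Ioi t, (x - t) * (GUE.q n x * GUE.p n x)) := by
  refine ⟨GUE.isUnit_one_sub_hermiteOp n, fun t => ?_⟩
  rw [GUE.largestEigenvalueCDF_eq_det hn, ← GUE.log_det_gramIic_eq_integral hn,
    Real.exp_log (GUE.gramIic_det_pos hn t)]
  exact ⟨GUE.hasFredholmDet_hermiteKernel n t, GUE.integrableOn_sub_mul_q_mul_p hn t, rfl⟩
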